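/- Let $\mathbb F_q\subseteq\mathbb F_{q^m}$ be finite fields with trace $\mathrm{Tr}(z)=z+z^q+\dots+z^{q^{m-1}}$, and let $a,b$ be coprime positive integers. Let $\mathcal X$ be a $C_{a,b}$ curve over $\mathbb F_{q^m}$, i.e. one with an irreducible non-singular affine plane model $$\alpha_{0a}y^a+\alpha_{b0}x^b+\sum_{ai+bj<ab}\alpha_{ij}x^iy^j=0,\qquad \alpha_{0a}\alpha_{b0}\neq0,$$ and let $P_\infty$ be its unique point at infinity. For a divisor $D$ let $\mathcal L(D)=\{h\in\mathbb F_{q^m}(\mathcal X)^*\mid (h)+D\ge 0\}\cup\{0\}$. A nonzero $h\in\bigcup_{t\ge0}\mathcal L(tP_\infty)$ can be written uniquely as $h=c\,x^{\beta}y^{\alpha}+r$ with $c\in\mathbb F_{q^m}^*$, $\alpha\le a-1$ and $r$ a linear combination of monomials $x^uy^v$ with $v\le a-1$ and $au+bv<a\beta+b\alpha$; put $\deg_{a,b}(h)=a\beta+b\alpha$ and $$\mathcal R(h)=\mathrm{Span}_{\mathbb F_{q^m}}\{x^uy^v\mid 0\le u\le\beta+b-1,\ 0\le v\le a-1,\ \text{not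 both } u\ge\beta \text{ and } v\ge\alpha\}.$$ Let $i\ge1$ and $s'>s\ge0$ be integers, let $g\in\mathcal L(s'P_\infty)$ with $\deg_{a,b}(g)=s'$, and let $f\in\mathcal L\big((s'(q^i+1)-1)P_\infty\big)$. Let $\mathcal P$ be a set of $\mathbb F_{q^m}$-rational points of $\mathcal X$ that are neither zeros nor poles of $g$. Then there is $f'\in\mathcal R\big(g^{q^i-q^{i-1}+1}\big)$ such that $$\mathrm{Tr}\Big(\frac{f}{g^{q^i+1}}(P)\Big)=\mathrm{Tr}\Big(\frac{f'}{g^{q^i+1}}(P)\Big)\qquad\text{for all }P\in\mathcal P.$$ -/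

import Mathlib

open Polynomial
open scoped Polynomial.Bivariate

noncomputable section

/-- A place of a field `K` over a subfield `F`: a valuation ring `F ⊆ O ⊊ K` of `K`. -/
structure FFPlace (F K : Type*) [Field F] [Field K] [Algebra F K] where
  ring : ValuationSubring K
  algebraMap_mem : ∀ c : F, algebraMap F K c ∈ ring
  ne_top : ring ≠ ⊤

namespace FFPlace

variable {F K : Type*} [Field F] [Field K] [Algebra F K]

/-- `h` lies in the maximal ideal of the place, i.e. `h` vanishes at `P`. -/
def Vanishes (P : FFPlace F K) (h : K) : Prop := P.ring.valuation h < 1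

/-- `t` generates the maximal ideal of the valuation ring of `P`. -/
def IsUniformizer (P : FFPlace F K) (t : K) : Prop :=
  t ≠ 0 ∧ P.Vanishes t ∧ ∀ h : K, P.Vanishes h → h / t ∈ P.ring

/-- `v_P(h) ≥ n` for the normalized discrete valuation `v_P` (with `v_P(0) = ∞`):
`h` is in `t ^ n O_P` for a uniformizer `t` at `P`. -/
def OrdGE (P : FFPlace F K) (h : K) (n : ℤ) : Prop :=
  ∃ t : K, P.IsUniformizer t ∧ h / t ^ n ∈ P.ring

/-- `v_P(h) = 0` (the nonzero function `h` has neither a zero nor a pole at `P`),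
i.e. `P` is outside the support of the divisor of `h`. -/
def NotInSupport (P : FFPlace F K) (h : K) : Prop := P.ring.valuation h = 1

/-- The residue field of `P` is `F`. -/
def IsRational (P : FFPlace F K) : Prop :=
  ∀ h ∈ P.ring, ∃ c : F, P.Vanishes (h - algebraMap F K c)

open Classical in
/-- The value `h(P) ∈ F` of a function that is regular at the rational place `P`
(`0` if `h` has no value in `F`). -/
def value (P : FFPlace F K) (h : K) : F :=
  if hc : ∃ c : F, P.Vanishes (h - algebraMap F K c) then hc.choose else 0

/-- The Riemann-Roch space `L(G) = {h | (h) + G ≥ 0} ∪ {0}` of a divisor `G`. -/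
def riemannRoch (G : FFPlace F K →₀ ℤ) : Set K :=
  {h | ∀ P : FFPlace F K, P.OrdGE h (-G P)}

end FFPlace

/-- A `C_{a,b}` curve over `F`, given by its plane affine equation
`α_{0a} y ^ a + α_{b0} x ^ b + ∑ α_{ij} x ^ i y ^ j = 0`, the sum being over `a i + b j < a b`.
The polynomial is an element of `F[x][y]`, so `(poly.coeff j).coeff i` is the coefficient of
`x ^ i y ^ j`. -/
structure CabCurve (F : Type*) [Field F] (a b : ℕ) where
  pos_left : 0 < a
  pos_right : 0 < b
  coprime : Nat.Coprime a b
  poly : F[X][Y]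
  coeff_y_ne : (poly.coeff a).coeff 0 ≠ 0
  coeff_x_ne : (poly.coeff 0).coeff b ≠ 0
  coeff_eq_zero : ∀ i j : ℕ, (i, j) ≠ (0, a) → (i, j) ≠ (b, 0) → a * b ≤ a * i + b * j →
    (poly.coeff j).coeff i = 0
  irreducible : Irreducible poly
  /-- No geometric point of the affine curve is singular. The partial derivative with respect to
  `x` is obtained by exchanging the two variables. -/
  nonsingular : ∀ u v : AlgebraicClosure F, aevalAeval u v poly = 0 →
    aevalAeval u v (derivative poly) ≠ 0 ∨
      aevalAeval v u (derivative (Polynomial.Bivariate.swap poly)) ≠ 0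

namespace CabCurve

variable {F : Type*} [Field F] {a b : ℕ}

/-- The affine coordinate ring `F[x, y] / (f_{a,b})`. -/
abbrev CoordinateRing (C : CabCurve F a b) : Type _ := AdjoinRoot C.poly

instance (C : CabCurve F a b) : IsDomain C.CoordinateRing :=
  AdjoinRoot.isDomain_of_prime C.irreducible.prime

/-- The function field of the curve. -/
abbrev FunctionField (C : CabCurve F a b) : Type _ := FractionRing C.CoordinateRing

/-- The function `x`. -/
def x (C : CabCurve F a b) : C.FunctionField :=
  algebraMap C.CoordinateRing C.FunctionField (AdjoinRoot.of C.poly X)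

/-- The function `y`. -/
def y (C : CabCurve F a b) : C.FunctionField :=
  algebraMap C.CoordinateRing C.FunctionField (AdjoinRoot.root C.poly)

/-- `P` is a point at infinity: it does not lie on the affine plane model. -/
def IsAtInfinity (C : CabCurve F a b) (P : FFPlace F C.FunctionField) : Prop :=
  ¬ (C.x ∈ P.ring ∧ C.y ∈ P.ring)

/-- `LT(h) = x ^ β y ^ α` with `α ≤ a - 1`: up to a nonzero scalar, `h` is `x ^ β y ^ α` plus a
linear combination of monomials `x ^ i y ^ j` with `j ≤ a - 1` of smaller weighted degree
`a i + b j`. -/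
def IsLeadingTerm (C : CabCurve F a b) (h : C.FunctionField) (β α : ℕ) : Prop :=
  α < a ∧ ∃ c : F, c ≠ 0 ∧
    h - c • (C.x ^ β * C.y ^ α) ∈ Submodule.span F
      {z : C.FunctionField | ∃ i j : ℕ, j < a ∧ a * i + b * j < a * β + b * α ∧
        z = C.x ^ i * C.y ^ j}

/-- `deg_{a,b}(h) = d`: the leading term of `h` has weighted degree `d`. -/
def HasWeightedDegree (C : CabCurve F a b) (h : C.FunctionField) (d : ℕ) : Prop :=
  ∃ β α : ℕ, C.IsLeadingTerm h β α ∧ a * β + b * α = d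

/-- The space `R(h)`: if `LT(h) = x ^ β y ^ α`, it is the span of the monomials `x ^ u y ^ v` with
`u ≤ β + b - 1` and `v ≤ a - 1`, not both `u ≥ β` and `v ≥ α`. -/
def remainderSpace (C : CabCurve F a b) (h : C.FunctionField) : Submodule F C.FunctionField :=
  Submodule.span F {z : C.FunctionField | ∃ β α : ℕ, C.IsLeadingTerm h β α ∧
    ∃ u v : ℕ, u ≤ β + b - 1 ∧ v ≤ a - 1 ∧ ¬ (β ≤ u ∧ α ≤ v) ∧ z = C.x ^ u * C.y ^ v}

end CabCurve

end

/-!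
Write `q` for the order of `k`, `deg` for the weighted degree `deg_{a,b}` and `G` for
`g ^ (q ^ i - q ^ (i - 1) + 1)`.

*Functions with poles only at infinity are polynomials in `x` and `y`.* A function without affine
poles lies in every valuation ring containing `F[x, y]`, so it is integral over `F[x]` and over
`F[y]`, as `y` is integral over `F[x]` and `x` over `F[y]`. By duality for the trace form,
multiplication by either partial derivative of the equation takes it into the coordinate ring
(`exists_derivative_mul_eq_eval₂`), the claim being trivial for a partial derivative that vanishes
on the curve, as it does in the inseparable case. By nonsingularity
and the Nullstellensatz, the partial derivatives generate the unit ideal of the coordinate ring, so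
the function itself belongs to it (`CabCurve.exists_eq_aevalAeval_of_forall_mem`).

*The pole order at infinity is the weighted degree.* The equation of the curve forces
`v(x) ^ b = v(y) ^ a > 1` for the multiplicative valuation `v` at infinity, so by Bézout `x` and `y`
have valuations `γ ^ a` and `γ ^ b` with `γ > 1`. As `a` and `b` are coprime, the monomials
`x ^ u y ^ w` with `w < a` have distinct weighted degrees, so no cancellation can occur
(`CabCurve.IsAtInfinity.mem_filtration_of_ordGE`).

*Reduction.* Division with remainder by `G` (`CabCurve.IsLeadingTerm.exists_quotient`) gives
`f = G h + r` with `r` in the remainder space of `G`. Then `f / g ^ (q ^ i + 1)` is the sum of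
`r / g ^ (q ^ i + 1)` and `h / g ^ (q ^ (i - 1))`. At a rational point, the value of the latter has
the same trace as its `q`-th power, the value of `h ^ q g / g ^ (q ^ i + 1)`. The bound
`deg f < s' (q ^ i + 1)` is exactly what makes `deg (h ^ q g) < deg f`
(`CabCurve.weightedDegree_descent_bound`), so iterating the division ends with quotient zero, and
the sum of the remainders is the required `f'`.
-/

/-! ### Evaluating bivariate polynomials on the curve -/

namespace CabCurve

variable {F : Type*} [Field F] {a b : ℕ}

theorem aevalAeval_eq_algebraMap_mk (C : CabCurve F a b) (p : F[X][Y]) :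
    aevalAeval C.x C.y p =
      algebraMap C.CoordinateRing C.FunctionField (AdjoinRoot.mk C.poly p) := by
  have key : aevalAeval (R := F) C.x C.y =
      (IsScalarTower.toAlgHom F C.CoordinateRing C.FunctionField).comp
        ((AdjoinRoot.mkₐ C.poly).restrictScalars F) := by
    ext
    · exact aevalAeval_X C.x C.y
    · exact aevalAeval_Y C.x C.y
  rw [key]; rfl

theorem aevalAeval_eq_zero_iff (C : CabCurve F a b) (p : F[X][Y]) :
    aevalAeval C.x C.y p = 0 ↔ C.poly ∣ p := by
  rw [aevalAeval_eq_algebraMap_mk, ← AdjoinRoot.mk_eq_zero]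
  exact map_eq_zero_iff _ (IsFractionRing.injective C.CoordinateRing C.FunctionField)

theorem exists_eq_aevalAeval_div (C : CabCurve F a b) (z : C.FunctionField) :
    ∃ r s : F[X][Y], z = aevalAeval C.x C.y r / aevalAeval C.x C.y s := by
  obtain ⟨r, s, -, rfl⟩ := IsFractionRing.div_surjective (A := C.CoordinateRing) z
  obtain ⟨r, rfl⟩ := AdjoinRoot.mk_surjective r
  obtain ⟨s, rfl⟩ := AdjoinRoot.mk_surjective s
  exact ⟨r, s, by simp only [aevalAeval_eq_algebraMap_mk]⟩

theorem aevalAeval_eq_sum (C : CabCurve F a b) (p : F[X][Y]) :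
    aevalAeval C.x C.y p = ∑ j ∈ Finset.range (p.natDegree + 1),
      ∑ i ∈ Finset.range ((p.coeff j).natDegree + 1),
        (p.coeff j).coeff i • (C.x ^ i * C.y ^ j) := by
  conv_lhs => rw [p.as_sum_range_C_mul_X_pow]
  rw [map_sum]
  refine Finset.sum_congr rfl fun j _ => ?_
  rw [map_mul, map_pow, aevalAeval_C, aevalAeval_Y, aeval_eq_sum_range, Finset.sum_mul]
  exact Finset.sum_congr rfl fun i _ => smul_mul_assoc _ _ _

theorem coeff_eq_zero_of_lt (C : CabCurve F a b) {j : ℕ} (hj : a < j) : C.poly.coeff j = 0 := by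
  ext i
  refine C.coeff_eq_zero i j ?_ ?_ ?_
  · simp; omega
  · simp; omega
  · nlinarith [Nat.mul_le_mul_left b hj.le]

theorem coeff_eq_C (C : CabCurve F a b) : C.poly.coeff a = .C ((C.poly.coeff a).coeff 0) := by
  ext i
  rw [coeff_C]
  split_ifs with h
  · rw [h]
  · refine C.coeff_eq_zero i a ?_ ?_ ?_
    · simp [h]
    · have := C.pos_left
      simp; omega
    · nlinarith [Nat.zero_le (a * i)]

theorem natDegree_poly (C : CabCurve F a b) : C.poly.natDegree = a := by
  refine natDegree_eq_of_le_of_coeff_ne_zero ?_ ?_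
  · exact natDegree_le_iff_coeff_eq_zero.2 fun j hj => C.coeff_eq_zero_of_lt hj
  · intro h
    exact C.coeff_y_ne (by rw [h, coeff_zero])

theorem isUnit_leadingCoeff_poly (C : CabCurve F a b) : IsUnit C.poly.leadingCoeff := by
  rw [leadingCoeff, natDegree_poly, coeff_eq_C]
  exact isUnit_C.2 (IsUnit.mk0 _ C.coeff_y_ne)

theorem aeval_x_injective (C : CabCurve F a b) :
    Function.Injective (aeval C.x : F[X] →ₐ[F] C.FunctionField) := by
  refine (injective_iff_map_eq_zero _).2 fun p hp => ?_
  rw [← aevalAeval_C C.x C.y, aevalAeval_eq_zero_iff] at hp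
  by_contra h
  have := natDegree_le_of_dvd hp (C_ne_zero.2 h)
  rw [natDegree_poly, natDegree_C] at this
  exact absurd C.pos_left (by omega)

theorem coeff_coeff_swap (p : F[X][Y]) (i j : ℕ) :
    ((Bivariate.swap p).coeff i).coeff j = (p.coeff j).coeff i := by
  induction p using Polynomial.induction_on' with
  | add p q hp hq => simp [hp, hq]
  | monomial n r =>
    induction r using Polynomial.induction_on' with
    | add p q hp hq => simp [hp, hq]
    | monomial m c =>
      rw [Bivariate.swap_monomial_monomial]
      simp only [coeff_monomial]
      split_ifs <;> simp_all [coeff_monomial]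

/-- The same curve with the roles of the two coordinates exchanged. -/
noncomputable def swap (C : CabCurve F a b) : CabCurve F b a where
  pos_left := C.pos_right
  pos_right := C.pos_left
  coprime := C.coprime.symm
  poly := Bivariate.swap C.poly
  coeff_y_ne := by rw [coeff_coeff_swap]; exact C.coeff_x_ne
  coeff_x_ne := by rw [coeff_coeff_swap]; exact C.coeff_y_ne
  coeff_eq_zero i j h h' hij := by
    rw [coeff_coeff_swap]
    refine C.coeff_eq_zero j i ?_ ?_ ?_
    · simp_all; tauto
    · simp_all; tauto
    · linarith
  irreducible := (MulEquiv.irreducible_iff Bivariate.swap).2 C.irreducible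
  nonsingular u v h := by
    rw [Bivariate.aevalAeval_swap] at h
    rw [Bivariate.swap_swap_apply]
    exact (C.nonsingular v u h).symm

theorem aeval_y_injective (C : CabCurve F a b) :
    Function.Injective (aeval C.y : F[X] →ₐ[F] C.FunctionField) := by
  refine (injective_iff_map_eq_zero _).2 fun p hp => ?_
  rw [← aevalAeval_C C.y C.x, ← Bivariate.aevalAeval_swap, aevalAeval_eq_zero_iff] at hp
  have hp' : C.swap.poly ∣ .C p := by
    have := map_dvd Bivariate.swap hp
    rwa [Bivariate.swap_swap_apply] at this
  by_contra h
  have := natDegree_le_of_dvd hp' (C_ne_zero.2 h)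
  rw [natDegree_poly, natDegree_C] at this
  exact absurd C.pos_right (by omega)

theorem x_ne_zero (C : CabCurve F a b) : C.x ≠ 0 := fun h =>
  X_ne_zero (C.aeval_x_injective (by rw [aeval_X, h, map_zero]))

theorem y_ne_zero (C : CabCurve F a b) : C.y ≠ 0 := fun h =>
  X_ne_zero (C.aeval_y_injective (by rw [aeval_X, h, map_zero]))

end CabCurve

/-! ### The weighted degree filtration -/

namespace CabCurve

variable {F : Type*} [Field F] {a b : ℕ}

/-- The span of the monomials `x ^ i y ^ j` of weighted degree `a i + b j` less than `d`. There is
no restriction on `j`, and the bound is strict, so that `C.filtration 0` is zero. -/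
noncomputable def filtration (C : CabCurve F a b) (d : ℕ) : Submodule F C.FunctionField :=
  Submodule.span F {z | ∃ i j : ℕ, a * i + b * j < d ∧ z = C.x ^ i * C.y ^ j}

theorem monomial_mem_filtration (C : CabCurve F a b) {i j d : ℕ} (h : a * i + b * j < d) :
    C.x ^ i * C.y ^ j ∈ C.filtration d :=
  Submodule.subset_span ⟨i, j, h, rfl⟩

theorem filtration_mono (C : CabCurve F a b) {d e : ℕ} (h : d ≤ e) :
    C.filtration d ≤ C.filtration e :=
  Submodule.span_mono fun _ ⟨i, j, hij, hz⟩ => ⟨i, j, hij.trans_le h, hz⟩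

theorem eq_zero_of_mem_filtration_zero (C : CabCurve F a b) {f : C.FunctionField}
    (hf : f ∈ C.filtration 0) : f = 0 := by
  simpa [filtration] using hf

theorem mul_mem_filtration (C : CabCurve F a b) {d e : ℕ} {f g : C.FunctionField}
    (hf : f ∈ C.filtration d) (hg : g ∈ C.filtration (e + 1)) : f * g ∈ C.filtration (d + e) := by
  have := Submodule.mul_mem_mul hf hg
  rw [filtration, filtration, Submodule.span_mul_span] at this
  refine Submodule.span_mono ?_ this
  rintro _ ⟨_, ⟨i, j, hij, rfl⟩, _, ⟨k, l, hkl, rfl⟩, rfl⟩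
  refine ⟨i + k, j + l, ?_, ?_⟩
  · linarith
  · simp only [pow_add]; ring

theorem pow_mem_filtration (C : CabCurve F a b) {d : ℕ} {f : C.FunctionField}
    (hf : f ∈ C.filtration (d + 1)) (n : ℕ) : f ^ n ∈ C.filtration (n * d + 1) := by
  induction n with
  | zero => simpa using C.monomial_mem_filtration (i := 0) (j := 0) (d := 0 * d + 1) (by simp)
  | succ n ih =>
    rw [pow_succ]
    exact C.filtration_mono (by linarith) (C.mul_mem_filtration ih hf)

theorem aevalAeval_mem_filtration (C : CabCurve F a b) {d : ℕ} (p : F[X][Y])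
    (h : ∀ i j, d ≤ a * i + b * j → (p.coeff j).coeff i = 0) :
    aevalAeval C.x C.y p ∈ C.filtration d := by
  rw [aevalAeval_eq_sum]
  refine Submodule.sum_mem _ fun j _ => Submodule.sum_mem _ fun i _ => ?_
  rcases lt_or_ge (a * i + b * j) d with hd | hd
  · exact Submodule.smul_mem _ _ (C.monomial_mem_filtration hd)
  · rw [h i j hd, zero_smul]
    exact Submodule.zero_mem _

theorem exists_aevalAeval_mem_filtration (C : CabCurve F a b) (p : F[X][Y]) :
    ∃ d, aevalAeval C.x C.y p ∈ C.filtration d := by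
  refine ⟨a * ((Bivariate.swap p).natDegree + 1) + b * (p.natDegree + 1),
    C.aevalAeval_mem_filtration p fun i j h => ?_⟩
  rcases lt_or_ge p.natDegree j with hj | hj
  · rw [coeff_eq_zero_of_natDegree_lt hj, coeff_zero]
  rcases lt_or_ge (Bivariate.swap p).natDegree i with hi | hi
  · rw [← coeff_coeff_swap, coeff_eq_zero_of_natDegree_lt hi, coeff_zero]
  · have := C.pos_left
    have := Nat.mul_le_mul_left a hi
    have := Nat.mul_le_mul_left b hj
    nlinarith

/-- The equation of the curve says that `y ^ a` is a nonzero multiple of `x ^ b` up to terms of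
smaller weighted degree. -/
theorem exists_y_pow_sub_mem_filtration (C : CabCurve F a b) :
    ∃ κ : F, κ ≠ 0 ∧ C.y ^ a - κ • C.x ^ b ∈ C.filtration (a * b) := by
  set α := (C.poly.coeff a).coeff 0 with hα
  set β := (C.poly.coeff 0).coeff b with hβ
  have hα0 : α ≠ 0 := C.coeff_y_ne
  have hβ0 : β ≠ 0 := C.coeff_x_ne
  have ha := C.pos_left
  have hb := C.pos_right
  have key := C.aevalAeval_mem_filtration (d := a * b)
    (C.poly - .C (.C α) * Polynomial.X ^ a - .C (.C β * Polynomial.X ^ b)) (by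
      intro i j hij
      rw [coeff_sub, coeff_sub, coeff_sub, coeff_sub, coeff_C_mul_X_pow, coeff_C]
      by_cases h1 : (i, j) = (0, a)
      · obtain ⟨rfl, rfl⟩ := Prod.mk.inj h1
        rw [if_pos rfl, if_neg ha.ne', coeff_zero, coeff_C_zero, ← hα]
        ring
      by_cases h2 : (i, j) = (b, 0)
      · obtain ⟨rfl, rfl⟩ := Prod.mk.inj h2
        rw [if_neg ha.ne, if_pos rfl, coeff_zero, coeff_C_mul_X_pow, if_pos rfl, ← hβ]
        ring
      rw [C.coeff_eq_zero i j h1 h2 hij]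
      have e1 : (if j = a then Polynomial.C α else 0).coeff i = 0 := by
        split_ifs with h
        · exact coeff_C_of_ne_zero fun h' => h1 (by rw [h, h'])
        · rfl
      have e2 : (if j = 0 then Polynomial.C β * Polynomial.X ^ b else 0).coeff i = 0 := by
        split_ifs with h
        · rw [coeff_C_mul_X_pow, if_neg fun h' => h2 (by rw [h, h'])]
        · rfl
      rw [e1, e2]; simp)
  have h0 : aevalAeval C.x C.y C.poly = 0 := (C.aevalAeval_eq_zero_iff _).2 dvd_rfl
  rw [map_sub, map_sub, h0, map_mul, map_pow, aevalAeval_C, aevalAeval_C, aevalAeval_Y, map_mul,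
    map_pow, aeval_C, aeval_C, aeval_X, ← Algebra.smul_def, ← Algebra.smul_def] at key
  refine ⟨-(α⁻¹ * β), neg_ne_zero.2 (mul_ne_zero (inv_ne_zero hα0) hβ0), ?_⟩
  convert Submodule.smul_mem _ (-α⁻¹) key using 1
  rw [smul_sub, smul_sub, smul_zero, smul_smul, smul_smul, neg_mul, inv_mul_cancel₀ hα0]
  module

/-- Replacing `y ^ a` by the multiple of `x ^ b` with the same weighted degree. -/
theorem exists_reduction_step (C : CabCurve F a b) :
    ∃ κ : F, κ ≠ 0 ∧ ∀ i j : ℕ, C.x ^ i * C.y ^ (j + a) - κ • (C.x ^ (i + b) * C.y ^ j) ∈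
      C.filtration (a * i + b * (j + a)) := by
  obtain ⟨κ, hκ, h⟩ := C.exists_y_pow_sub_mem_filtration
  refine ⟨κ, hκ, fun i j => ?_⟩
  have := C.mul_mem_filtration h (C.monomial_mem_filtration (Nat.lt_succ_self (a * i + b * j)))
  convert C.filtration_mono (le_of_eq _) this using 1
  · rw [sub_mul, smul_mul_assoc, pow_add, pow_add]
    congr 1
    · ring
    · congr 1; ring
  · ring

/-- Monomials with exponent of `y` less than `a` suffice to span the filtration. -/
theorem filtration_eq_span_reduced (C : CabCurve F a b) (d : ℕ) :
    C.filtration d = Submodule.span F {z : C.FunctionField | ∃ i j : ℕ, j < a ∧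
      a * i + b * j < d ∧ z = C.x ^ i * C.y ^ j} := by
  refine le_antisymm (Submodule.span_le.2 ?_)
    (Submodule.span_mono fun _ ⟨i, j, _, hij, hz⟩ => ⟨i, j, hij, hz⟩)
  rintro _ ⟨i, j, hij, rfl⟩
  obtain ⟨κ, -, hw⟩ := C.exists_y_pow_sub_mem_filtration
  induction j using Nat.strong_induction_on generalizing i with
  | _ j ih =>
    rcases lt_or_ge j a with hj | hj
    · exact Submodule.subset_span ⟨i, j, hj, hij, rfl⟩
    obtain ⟨l, rfl⟩ := Nat.exists_eq_add_of_le hj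
    have ha := C.pos_left
    have e : C.x ^ i * C.y ^ (a + l) =
        κ • (C.x ^ (i + b) * C.y ^ l) + (C.x ^ i * C.y ^ l) * (C.y ^ a - κ • C.x ^ b) := by
      rw [mul_sub, mul_smul_comm, pow_add, pow_add]
      have : C.x ^ i * C.y ^ l * C.x ^ b = C.x ^ i * C.x ^ b * C.y ^ l := by ring
      rw [this]; ring
    rw [e]
    refine Submodule.add_mem _ (Submodule.smul_mem _ _ (ih l (by omega) _ (by linarith))) ?_
    generalize C.y ^ a - κ • C.x ^ b = w at hw
    induction hw using Submodule.span_induction with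
    | zero => rw [mul_zero]; exact Submodule.zero_mem _
    | add u v _ _ hu hv => rw [mul_add]; exact Submodule.add_mem _ hu hv
    | smul c u _ hu => rw [mul_smul_comm]; exact Submodule.smul_mem _ _ hu
    | mem z hz =>
      obtain ⟨i', j', hij', rfl⟩ := hz
      have hj' : j' < a := by
        by_contra h
        have := Nat.mul_le_mul_left b (not_lt.1 h)
        nlinarith [Nat.zero_le (a * i')]
      have := ih (l + j') (by omega) (i + i') (by linarith)
      rwa [show C.x ^ i * C.y ^ l * (C.x ^ i' * C.y ^ j') = C.x ^ (i + i') * C.y ^ (l + j') by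
        rw [pow_add, pow_add]; ring]

/-- Every monomial has the same leading term as a multiple of a monomial in which the exponent of
`y` is less than `a`. -/
theorem exists_reduced_monomial (C : CabCurve F a b) (i j : ℕ) :
    ∃ i' j' : ℕ, ∃ κ : F, j' < a ∧ κ ≠ 0 ∧ a * i' + b * j' = a * i + b * j ∧
      C.x ^ i * C.y ^ j - κ • (C.x ^ i' * C.y ^ j') ∈ C.filtration (a * i + b * j) := by
  obtain ⟨κ, hκ, h⟩ := C.exists_reduction_step
  induction j using Nat.strong_induction_on generalizing i with
  | _ j ih =>
    rcases lt_or_ge j a with hj | hj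
    · exact ⟨i, j, 1, hj, one_ne_zero, rfl, by simp⟩
    obtain ⟨l, rfl⟩ := Nat.exists_eq_add_of_le' hj
    have ha := C.pos_left
    obtain ⟨i', j', κ', hj', hκ', hd, hm⟩ := ih l (by omega) (i + b)
    have hd' : a * (i + b) + b * l = a * i + b * (l + a) := by ring
    rw [hd'] at hd hm
    refine ⟨i', j', κ * κ', hj', mul_ne_zero hκ hκ', hd, ?_⟩
    convert Submodule.add_mem _ (h i l) (Submodule.smul_mem _ κ hm) using 1
    rw [smul_sub, smul_smul]; abel

/-! ### Leading terms and division with remainder -/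

theorem IsLeadingTerm.exists_sub_mem_filtration {C : CabCurve F a b} {h : C.FunctionField}
    {β α : ℕ} (hh : C.IsLeadingTerm h β α) : ∃ c : F, c ≠ 0 ∧
      h - c • (C.x ^ β * C.y ^ α) ∈ C.filtration (a * β + b * α) := by
  obtain ⟨-, c, hc, hm⟩ := hh
  exact ⟨c, hc, by rwa [filtration_eq_span_reduced]⟩

theorem mem_filtration_of_sub_mem (C : CabCurve F a b) {h : C.FunctionField} {β α : ℕ} {c : F}
    (hm : h - c • (C.x ^ β * C.y ^ α) ∈ C.filtration (a * β + b * α)) :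
    h ∈ C.filtration (a * β + b * α + 1) := by
  rw [← sub_add_cancel h (c • (C.x ^ β * C.y ^ α))]
  exact Submodule.add_mem _ (C.filtration_mono (Nat.le_succ _) hm)
    (Submodule.smul_mem _ _ (C.monomial_mem_filtration (Nat.lt_succ_self _)))

theorem IsLeadingTerm.mem_filtration {C : CabCurve F a b} {h : C.FunctionField} {β α : ℕ}
    (hh : C.IsLeadingTerm h β α) : h ∈ C.filtration (a * β + b * α + 1) := by
  obtain ⟨c, -, hm⟩ := hh.exists_sub_mem_filtration
  exact C.mem_filtration_of_sub_mem hm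

theorem IsLeadingTerm.exists_pow {C : CabCurve F a b} {h : C.FunctionField} {β α : ℕ}
    (hh : C.IsLeadingTerm h β α) (n : ℕ) : ∃ β' α' : ℕ, C.IsLeadingTerm (h ^ n) β' α' ∧
      a * β' + b * α' = n * (a * β + b * α) := by
  obtain ⟨c, hc, hm⟩ := hh.exists_sub_mem_filtration
  have hpow : h ^ n - c ^ n • (C.x ^ (n * β) * C.y ^ (n * α)) ∈
      C.filtration (n * (a * β + b * α)) := by
    induction n with
    | zero => simp
    | succ n ih =>
      have h1 := C.mul_mem_filtration hm (C.pow_mem_filtration hh.mem_filtration n)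
      have h2 := C.mul_mem_filtration ih (C.monomial_mem_filtration
        (Nat.lt_succ_self (a * β + b * α)))
      have e : (n + 1) * (a * β + b * α) = n * (a * β + b * α) + (a * β + b * α) := by ring
      rw [e]
      rw [add_comm] at h1
      convert Submodule.add_mem _ h1 (Submodule.smul_mem _ c h2) using 1
      simp only [Algebra.smul_def, map_pow]
      ring
  obtain ⟨β', α', κ, hα', hκ, hd, hr⟩ := C.exists_reduced_monomial (n * β) (n * α)
  have hd' : a * (n * β) + b * (n * α) = n * (a * β + b * α) := by ring
  rw [hd'] at hd hr
  refine ⟨β', α', ⟨hα', c ^ n * κ, mul_ne_zero (pow_ne_zero _ hc) hκ, ?_⟩, hd⟩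
  rw [← filtration_eq_span_reduced, hd]
  convert Submodule.add_mem _ hpow (Submodule.smul_mem _ (c ^ n) hr) using 1
  rw [smul_sub, smul_smul]; abel

/-- A reduced monomial that is not among the generators of `C.remainderSpace G` is the leading
monomial of a multiple of `G`. -/
theorem IsLeadingTerm.exists_mul_sub_mem {C : CabCurve F a b} {G : C.FunctionField} {β α : ℕ}
    (hG : C.IsLeadingTerm G β α) {u v : ℕ} (hv : v < a)
    (huv : ¬ (u ≤ β + b - 1 ∧ ¬ (β ≤ u ∧ α ≤ v))) :
    ∃ k l : ℕ, ∃ c : F, c ≠ 0 ∧ a * k + b * l + (a * β + b * α) = a * u + b * v ∧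
      G * (C.x ^ k * C.y ^ l) - c • (C.x ^ u * C.y ^ v) ∈ C.filtration (a * u + b * v) := by
  obtain ⟨c, hc, hm⟩ := hG.exists_sub_mem_filtration
  have hα := hG.1
  have hb := C.pos_right
  by_cases h : β ≤ u ∧ α ≤ v
  · obtain ⟨k, rfl⟩ := Nat.exists_eq_add_of_le h.1
    obtain ⟨l, rfl⟩ := Nat.exists_eq_add_of_le h.2
    refine ⟨k, l, c, hc, by ring, ?_⟩
    convert C.filtration_mono (le_of_eq _) (C.mul_mem_filtration hm
      (C.monomial_mem_filtration (Nat.lt_succ_self (a * k + b * l)))) using 1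
    · rw [sub_mul, smul_mul_assoc, pow_add, pow_add]
      congr 2; ring
    · ring
  · have hu : β + b ≤ u := by
      by_contra h'
      exact huv ⟨by omega, h⟩
    have hv' : v < α := by
      by_contra h'
      exact h ⟨by omega, by omega⟩
    obtain ⟨k, rfl⟩ := Nat.exists_eq_add_of_le hu
    obtain ⟨l, hl⟩ : ∃ l, α + l = v + a := ⟨v + a - α, by omega⟩
    obtain ⟨κ, hκ, hs⟩ := C.exists_reduction_step
    have hd : a * k + b * l + (a * β + b * α) = a * (β + b + k) + b * v := by
      have : b * (α + l) = b * (v + a) := by rw [hl]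
      linarith
    refine ⟨k, l, c * κ, mul_ne_zero hc hκ, hd, ?_⟩
    have h1 := C.mul_mem_filtration hm
      (C.monomial_mem_filtration (Nat.lt_succ_self (a * k + b * l)))
    have h2 := hs (β + k) v
    rw [show a * (β + k) + b * (v + a) = a * (β + b + k) + b * v by ring, ← hl] at h2
    rw [add_comm, hd] at h1
    convert Submodule.add_mem _ h1 (Submodule.smul_mem _ c h2) using 1
    rw [smul_sub, smul_smul, show β + k + b = β + b + k by ring, sub_mul, smul_mul_assoc,
      show C.x ^ β * C.y ^ α * (C.x ^ k * C.y ^ l) = C.x ^ (β + k) * C.y ^ (α + l) by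
        simp only [pow_add]; ring]
    abel

/-- Division with remainder by `G`: the remainder lies in `C.remainderSpace G` and the weighted
degree of the quotient drops by that of `G`. The truncated subtraction is intended: if the bound on
the degree of `f` does not exceed the degree of `G`, then the quotient is zero. -/
theorem IsLeadingTerm.exists_quotient {C : CabCurve F a b} {G : C.FunctionField} {β α : ℕ}
    (hG : C.IsLeadingTerm G β α) {d : ℕ} {f : C.FunctionField} (hf : f ∈ C.filtration d) :
    ∃ h ∈ C.filtration (d - (a * β + b * α)), f - G * h ∈ C.remainderSpace G := by
  induction d generalizing f with
  | zero =>
    rw [C.eq_zero_of_mem_filtration_zero hf]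
    exact ⟨0, Submodule.zero_mem _, by simp⟩
  | succ d ih =>
    rw [filtration_eq_span_reduced] at hf
    induction hf using Submodule.span_induction with
    | zero => exact ⟨0, Submodule.zero_mem _, by simp⟩
    | add f₁ f₂ _ _ h₁ h₂ =>
      obtain ⟨k₁, hk₁, hr₁⟩ := h₁
      obtain ⟨k₂, hk₂, hr₂⟩ := h₂
      refine ⟨k₁ + k₂, Submodule.add_mem _ hk₁ hk₂, ?_⟩
      convert Submodule.add_mem _ hr₁ hr₂ using 1
      ring
    | smul c f _ h =>
      obtain ⟨k, hk, hr⟩ := h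
      refine ⟨c • k, Submodule.smul_mem _ _ hk, ?_⟩
      rw [mul_smul_comm, ← smul_sub]
      exact Submodule.smul_mem _ _ hr
    | mem z hz =>
      obtain ⟨u, v, hv, huv, rfl⟩ := hz
      by_cases hR : u ≤ β + b - 1 ∧ ¬ (β ≤ u ∧ α ≤ v)
      · refine ⟨0, Submodule.zero_mem _, ?_⟩
        rw [mul_zero, sub_zero]
        exact Submodule.subset_span ⟨β, α, hG, u, v, hR.1, Nat.le_sub_one_of_lt hv, hR.2, rfl⟩
      · obtain ⟨k, l, c, hc, hd, hm⟩ := hG.exists_mul_sub_mem hv hR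
        obtain ⟨h, hh, hr⟩ := ih (C.filtration_mono (Nat.lt_succ_iff.1 huv) hm)
        refine ⟨c⁻¹ • (C.x ^ k * C.y ^ l - h), Submodule.smul_mem _ _ (Submodule.sub_mem _
          (C.monomial_mem_filtration (by omega)) (C.filtration_mono (by omega) hh)), ?_⟩
        convert Submodule.smul_mem _ (-c⁻¹) hr using 1
        rw [mul_smul_comm, mul_sub, smul_sub, smul_sub, smul_sub, smul_smul, neg_mul,
          inv_mul_cancel₀ hc]
        module

end CabCurve

/-! ### The place at infinity -/

namespace FFPlace

variable {F K : Type*} [Field F] [Field K] [Algebra F K]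

theorem valuation_algebraMap (P : FFPlace F K) {c : F} (hc : c ≠ 0) :
    P.ring.valuation (algebraMap F K c) = 1 := by
  refine le_antisymm ((P.ring.valuation_le_one_iff _).2 (P.algebraMap_mem c)) ?_
  have h := (P.ring.valuation_le_one_iff _).2 (P.algebraMap_mem c⁻¹)
  rw [map_inv₀, map_inv₀] at h
  exact (inv_le_one₀ (by simp [zero_lt_iff, hc])).1 h

theorem valuation_smul (P : FFPlace F K) {c : F} (hc : c ≠ 0) (z : K) :
    P.ring.valuation (c • z) = P.ring.valuation z := by
  rw [Algebra.smul_def, map_mul, P.valuation_algebraMap hc, one_mul]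

theorem valuation_lt_of_mem_span (P : FFPlace F K) {M : P.ring.ValueGroup} (hM : 0 < M)
    {s : Set K} (hs : ∀ z ∈ s, P.ring.valuation z < M) {z : K} (hz : z ∈ Submodule.span F s) :
    P.ring.valuation z < M := by
  induction hz using Submodule.span_induction with
  | zero => rwa [map_zero]
  | add u v _ _ hu hv => exact Valuation.map_add_lt _ hu hv
  | mem z hz => exact hs z hz
  | smul c u _ hu =>
    rcases eq_or_ne c 0 with rfl | hc
    · rwa [zero_smul, map_zero]
    · rwa [P.valuation_smul hc]

end FFPlace

namespace CabCurve

variable {F : Type*} [Field F] {a b : ℕ}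

/-- At infinity the two leading terms of the equation of the curve dominate all the others, so they
have equal valuation. -/
theorem IsAtInfinity.valuation_pow {C : CabCurve F a b} {P : FFPlace F C.FunctionField}
    (hP : C.IsAtInfinity P) : P.ring.valuation C.x ^ b = P.ring.valuation C.y ^ a ∧
      1 < P.ring.valuation C.x ^ b := by
  set v := P.ring.valuation with hv
  have ha := C.pos_left.ne'
  have hb := C.pos_right.ne'
  set M := max (v C.x ^ b) (v C.y ^ a) with hM
  have hM1 : 1 < M := by
    by_contra h
    obtain ⟨h1, h2⟩ := max_le_iff.1 (not_lt.1 h)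
    exact hP ⟨(P.ring.valuation_le_one_iff _).1 ((pow_le_one_iff hb).1 h1),
      (P.ring.valuation_le_one_iff _).1 ((pow_le_one_iff ha).1 h2)⟩
  obtain ⟨κ, hκ, hw⟩ := C.exists_y_pow_sub_mem_filtration
  have hwM : v (C.y ^ a - κ • C.x ^ b) < M := by
    refine P.valuation_lt_of_mem_span (zero_lt_one.trans hM1) ?_ hw
    rintro _ ⟨i, j, hij, rfl⟩
    rw [← hv, map_mul, map_pow, map_pow]
    refine lt_of_pow_lt_pow_left₀ (a * b) zero_le ?_
    calc (v C.x ^ i * v C.y ^ j) ^ (a * b)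
        = (v C.x ^ b) ^ (a * i) * (v C.y ^ a) ^ (b * j) := by
          rw [mul_pow, ← pow_mul, ← pow_mul, ← pow_mul, ← pow_mul]
          congr 2 <;> ring
      _ ≤ M ^ (a * i) * M ^ (b * j) :=
          mul_le_mul' (pow_le_pow_left₀ zero_le (le_max_left _ _) _)
            (pow_le_pow_left₀ zero_le (le_max_right _ _) _)
      _ = M ^ (a * i + b * j) := (pow_add _ _ _).symm
      _ < M ^ (a * b) := pow_lt_pow_right₀ hM1 hij
  have heq : v C.x ^ b = v C.y ^ a := by
    rcases lt_trichotomy (v C.x ^ b) (v C.y ^ a) with h | h | h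
    · have h1 := Valuation.map_add_lt v hwM (show v (κ • C.x ^ b) < M by
        rw [hv, P.valuation_smul hκ, map_pow]; exact lt_max_of_lt_right h)
      rw [sub_add_cancel, map_pow, hM, max_eq_right h.le] at h1
      exact absurd h1 (lt_irrefl _)
    · exact h
    · have h1 := Valuation.map_sub_lt v (show v (C.y ^ a) < M by
        rw [map_pow]; exact lt_max_of_lt_left h) hwM
      rw [sub_sub_cancel, hv, P.valuation_smul hκ, map_pow, hM, max_eq_left h.le] at h1
      exact absurd h1 (lt_irrefl _)
  refine ⟨heq, ?_⟩
  rwa [hM, ← heq, max_self] at hM1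

/-- By Bézout, there is a function whose valuation `γ > 1` at infinity satisfies `v(x) = γ ^ a` and
`v(y) = γ ^ b`. -/
theorem IsAtInfinity.exists_valuation_eq {C : CabCurve F a b} {P : FFPlace F C.FunctionField}
    (hP : C.IsAtInfinity P) : ∃ w : C.FunctionField, 1 < P.ring.valuation w ∧
      P.ring.valuation w ^ a = P.ring.valuation C.x ∧
      P.ring.valuation w ^ b = P.ring.valuation C.y := by
  obtain ⟨h, h1⟩ := hP.valuation_pow
  obtain ⟨r, s, hrs⟩ := Nat.isCoprime_iff_coprime.2 C.coprime
  have hx : P.ring.valuation C.x ≠ 0 := (Valuation.ne_zero_iff _).2 C.x_ne_zero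
  have hy : P.ring.valuation C.y ≠ 0 := (Valuation.ne_zero_iff _).2 C.y_ne_zero
  have hwa : P.ring.valuation (C.x ^ r * C.y ^ s) ^ a = P.ring.valuation C.x := by
    rw [map_mul, map_zpow₀, map_zpow₀, mul_pow, ← zpow_natCast, ← zpow_natCast, ← zpow_mul,
      ← zpow_mul, mul_comm s, zpow_mul _ (a : ℤ), zpow_natCast _ a, ← h, ← zpow_natCast,
      ← zpow_mul, ← zpow_add₀ hx, mul_comm (b : ℤ), hrs, zpow_one]
  have hwb : P.ring.valuation (C.x ^ r * C.y ^ s) ^ b = P.ring.valuation C.y := by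
    rw [map_mul, map_zpow₀, map_zpow₀, mul_pow, ← zpow_natCast, ← zpow_natCast, ← zpow_mul,
      ← zpow_mul, mul_comm r, zpow_mul _ (b : ℤ), zpow_natCast _ b, h, ← zpow_natCast,
      ← zpow_mul, ← zpow_add₀ hy, mul_comm (a : ℤ), hrs, zpow_one]
  refine ⟨_, ?_, hwa, hwb⟩
  rw [← hwa, ← pow_mul] at h1
  exact (one_lt_pow_iff (mul_ne_zero C.pos_left.ne' C.pos_right.ne')).1 h1

theorem valuation_lt_of_mem_filtration (C : CabCurve F a b) {P : FFPlace F C.FunctionField}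
    {w : C.FunctionField} (hw : 1 < P.ring.valuation w)
    (hx : P.ring.valuation w ^ a = P.ring.valuation C.x)
    (hy : P.ring.valuation w ^ b = P.ring.valuation C.y) {d : ℕ} {f : C.FunctionField}
    (hf : f ∈ C.filtration d) : P.ring.valuation f < P.ring.valuation w ^ d := by
  refine P.valuation_lt_of_mem_span (pow_pos (zero_lt_one.trans hw) _) ?_ hf
  rintro _ ⟨i, j, hij, rfl⟩
  rw [map_mul, map_pow, map_pow, ← hx, ← hy, ← pow_mul, ← pow_mul, ← pow_add]
  exact pow_lt_pow_right₀ hw hij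

theorem valuation_eq_of_sub_mem_filtration (C : CabCurve F a b) {P : FFPlace F C.FunctionField}
    {w : C.FunctionField} (hw : 1 < P.ring.valuation w)
    (hx : P.ring.valuation w ^ a = P.ring.valuation C.x)
    (hy : P.ring.valuation w ^ b = P.ring.valuation C.y) {β α : ℕ} {c : F} (hc : c ≠ 0)
    {f : C.FunctionField}
    (hf : f - c • (C.x ^ β * C.y ^ α) ∈ C.filtration (a * β + b * α)) :
    P.ring.valuation f = P.ring.valuation w ^ (a * β + b * α) := by
  have h := C.valuation_lt_of_mem_filtration hw hx hy hf
  have hm : P.ring.valuation (c • (C.x ^ β * C.y ^ α)) =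
      P.ring.valuation w ^ (a * β + b * α) := by
    rw [P.valuation_smul hc, map_mul, map_pow, map_pow, ← hx, ← hy, ← pow_mul, ← pow_mul,
      ← pow_add]
  rw [← hm] at h ⊢
  rw [← Valuation.map_add_eq_of_lt_left _ h, add_sub_cancel]

/-- Each graded piece of the filtration is at most one-dimensional, because reduced monomials of
equal weighted degree are equal. -/
theorem mem_filtration_or_exists_sub_mem (C : CabCurve F a b) {d : ℕ} {f : C.FunctionField}
    (hf : f ∈ C.filtration (d + 1)) : f ∈ C.filtration d ∨ ∃ β α : ℕ, a * β + b * α = d ∧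
      ∃ c : F, c ≠ 0 ∧ f - c • (C.x ^ β * C.y ^ α) ∈ C.filtration d := by
  have ha := C.pos_left
  by_cases hd : ∃ β α : ℕ, α < a ∧ a * β + b * α = d
  · obtain ⟨β, α, hα, hβα⟩ := hd
    have key : ∃ c : F, f - c • (C.x ^ β * C.y ^ α) ∈ C.filtration d := by
      rw [filtration_eq_span_reduced] at hf
      induction hf using Submodule.span_induction with
      | zero => exact ⟨0, by simp⟩
      | add f₁ f₂ _ _ h₁ h₂ =>
        obtain ⟨c₁, h₁⟩ := h₁
        obtain ⟨c₂, h₂⟩ := h₂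
        refine ⟨c₁ + c₂, ?_⟩
        convert Submodule.add_mem _ h₁ h₂ using 1
        module
      | smul e f _ h =>
        obtain ⟨c, h⟩ := h
        refine ⟨e * c, ?_⟩
        rw [mul_smul, ← smul_sub]
        exact Submodule.smul_mem _ _ h
      | mem z hz =>
        obtain ⟨i, j, hj, hij, rfl⟩ := hz
        rcases (Nat.lt_succ_iff.1 hij).lt_or_eq with h | h
        · exact ⟨0, by rw [zero_smul, sub_zero]; exact C.monomial_mem_filtration h⟩
        · have hmod : b * j ≡ b * α [MOD a] := by
            have : a * i + b * j ≡ a * β + b * α [MOD a] := by rw [h, hβα]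
            simpa [Nat.ModEq, Nat.mul_add_mod] using this
          have hjα : j = α :=
            (Nat.ModEq.cancel_left_of_coprime C.coprime hmod).eq_of_lt_of_lt hj hα
          subst hjα
          have hiβ : i = β := Nat.eq_of_mul_eq_mul_left ha (by omega)
          subst hiβ
          exact ⟨1, by simp⟩
    obtain ⟨c, hc⟩ := key
    rcases eq_or_ne c 0 with rfl | hc0
    · left; simpa using hc
    · exact .inr ⟨β, α, hβα, c, hc0, hc⟩
  · left
    rw [filtration_eq_span_reduced] at hf
    refine Submodule.span_mono ?_ hf
    rintro _ ⟨i, j, hj, hij, rfl⟩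
    refine ⟨i, j, lt_of_le_of_ne (Nat.lt_succ_iff.1 hij) fun h => hd ⟨i, j, hj, h⟩, rfl⟩

/-- The pole order at infinity bounds the weighted degree of a polynomial function. -/
theorem IsAtInfinity.mem_filtration_of_ordGE {C : CabCurve F a b}
    {P : FFPlace F C.FunctionField} (hP : C.IsAtInfinity P) {n : ℕ} (p : F[X][Y])
    (h : P.OrdGE (aevalAeval C.x C.y p) (-(n : ℤ))) :
    aevalAeval C.x C.y p ∈ C.filtration (n + 1) := by
  obtain ⟨w, hw, hx, hy⟩ := hP.exists_valuation_eq
  have hw0 : 0 < P.ring.valuation w := zero_lt_one.trans hw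
  have hle : P.ring.valuation (aevalAeval C.x C.y p) ≤ P.ring.valuation w ^ n := by
    obtain ⟨t, ⟨ht0, ht, hu⟩, hf⟩ := h
    have hvt : 0 < P.ring.valuation t := zero_lt_iff.2 ((Valuation.ne_zero_iff _).2 ht0)
    -- `w⁻¹` vanishes at `P`, so it is divisible by the uniformizer `t`
    have h1 := hu w⁻¹ (by rw [FFPlace.Vanishes, map_inv₀]; exact (inv_lt_one₀ hw0).2 hw)
    rw [← P.ring.valuation_le_one_iff, map_div₀, map_inv₀, div_le_one₀ hvt] at h1
    rw [← P.ring.valuation_le_one_iff, zpow_neg, div_inv_eq_mul, zpow_natCast, map_mul,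
      map_pow] at hf
    have h2 : (P.ring.valuation w)⁻¹ ^ n ≤ P.ring.valuation t ^ n :=
      pow_le_pow_left₀ zero_le h1 n
    have h3 := (mul_le_mul_right h2 (P.ring.valuation (aevalAeval C.x C.y p))).trans hf
    rwa [inv_pow, ← div_eq_mul_inv, div_le_one₀ (pow_pos hw0 n)] at h3
  obtain ⟨d, hd⟩ := C.exists_aevalAeval_mem_filtration p
  generalize aevalAeval C.x C.y p = f at hle hd
  clear h
  induction d with
  | zero => exact C.filtration_mono (Nat.zero_le _) hd
  | succ d ih =>
    rcases C.mem_filtration_or_exists_sub_mem hd with h | ⟨β, α, rfl, c, hc, h⟩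
    · exact ih h
    · rw [C.valuation_eq_of_sub_mem_filtration hw hx hy hc h, pow_le_pow_iff_right₀ hw] at hle
      exact C.filtration_mono (Nat.succ_le_succ hle) hd

end CabCurve

/-! ### Normality of the affine model -/

theorem ValuationSubring.mem_of_isIntegralElem {A L : Type*} [CommRing A] [Field L]
    {φ : A →+* L} {V : ValuationSubring L} (hV : ∀ c, φ c ∈ V) {z : L}
    (hz : φ.IsIntegralElem z) : z ∈ V := by
  obtain ⟨p, hp, hpz⟩ := hz
  have hint : IsIntegral V z := by
    refine ⟨p.map (φ.codRestrict V.toSubring hV), hp.map _, ?_⟩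
    rw [← hpz]
    exact eval₂_map _ _ _
  obtain ⟨t, rfl⟩ := IsIntegrallyClosed.isIntegral_iff.1 hint
  exact t.2

theorem RingHom.isIntegralElem_of_forall_valuationSubring {A L : Type*} [CommRing A] [Field L]
    {φ : A →+* L} {z : L} (h : ∀ V : ValuationSubring L, (∀ c, φ c ∈ V) → z ∈ V) :
    φ.IsIntegralElem z := by
  have hz : z ∈ (integralClosure (Subring.closure (Set.range φ)) L).toSubring := by
    rw [← iInf_valuationSubring_superset, Subring.mem_iInf]
    rintro ⟨V, hV⟩
    exact h V fun c => hV ⟨c, rfl⟩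
  obtain ⟨p, hp, hpz⟩ := hz
  have hcl : ∀ c, φ c ∈ Subring.closure (Set.range φ) := fun c => Subring.subset_closure ⟨c, rfl⟩
  have hsurj : Function.Surjective (φ.codRestrict _ hcl) := by
    rintro ⟨c, hc⟩
    have hc' : c ∈ φ.range := by rwa [← φ.coe_range, Subring.closure_eq] at hc
    obtain ⟨d, rfl⟩ := hc'
    exact ⟨d, rfl⟩
  obtain ⟨r, hr, -, hrm⟩ := lifts_and_natDegree_eq_and_monic
    ((mem_lifts p).2 (map_surjective _ hsurj p)) hp
  refine ⟨r, hrm, ?_⟩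
  rw [← hpz, ← hr, eval₂_map]
  rfl

theorem RingHom.isIntegralElem_of_isUnit_leadingCoeff {A L : Type*} [CommRing A] [CommRing L]
    {φ : A →+* L} {y : L} {p : A[X]} (hp : IsUnit p.leadingCoeff) (hy : p.eval₂ φ y = 0) :
    φ.IsIntegralElem y := by
  obtain ⟨u, hu⟩ := hp
  refine ⟨Polynomial.C ((u⁻¹ : Aˣ) : A) * p, ?_, ?_⟩
  · exact monic_C_mul_of_mul_leadingCoeff_eq_one (by rw [← hu, Units.inv_mul])
  · rw [eval₂_mul, hy, mul_zero]

/-- If `L` is generated over the fraction field of `A` by a root `y` of `p`, then `p'(y)` multiplies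
the integral closure of `A` in `L` into `A[y]`. In the separable case this is duality with respect
to the trace form; otherwise `p'(y) = 0`. -/
theorem exists_derivative_mul_eq_eval₂ {A L : Type*} [CommRing A] [IsDomain A]
    [IsIntegrallyClosed A] [Field L] {φ : A →+* L} (hφ : Function.Injective φ) {y : L} {p : A[X]}
    (hp : Irreducible p) (hlc : IsUnit p.leadingCoeff) (hy : p.eval₂ φ y = 0)
    (hgen : ∀ z : L, ∃ r s : A[X], z = r.eval₂ φ y / s.eval₂ φ y) {z : L}
    (hz : φ.IsIntegralElem z) : ∃ r : A[X], (derivative p).eval₂ φ y * z = r.eval₂ φ y := by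
  let := φ.toAlgebra
  have : FaithfulSMul A L := (faithfulSMul_iff_algebraMap_injective A L).2 hφ
  have hyint : IsIntegral A y := RingHom.isIntegralElem_of_isUnit_leadingCoeff hlc hy
  by_cases hd : (derivative p).eval₂ φ y = 0
  · exact ⟨0, by rw [hd, zero_mul, eval₂_zero]⟩
  let K := FractionRing A
  let : Algebra K L := FractionRing.liftAlgebra A L
  obtain ⟨u, hu⟩ := minpoly.isIntegrallyClosed_dvd hyint hy
  have huu : IsUnit u := (hp.isUnit_or_isUnit hu).resolve_left (minpoly.not_isUnit A y)
  obtain ⟨c, -, rfl⟩ := Polynomial.isUnit_iff.1 huu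
  have hK : minpoly K y = (minpoly A y).map (algebraMap A K) :=
    minpoly.isIntegrallyClosed_eq_field_fractions' K hyint
  have hder : (derivative p).eval₂ φ y = aeval y (derivative (minpoly K y)) * φ c := by
    rw [hK, derivative_map, aeval_map_algebraMap, hu, derivative_mul, derivative_C, mul_zero,
      add_zero, eval₂_mul, eval₂_C]
    rfl
  rw [hder] at hd ⊢
  have hd0 : aeval y (derivative (minpoly K y)) ≠ 0 := left_ne_zero_of_mul hd
  have hyK : IsIntegral K y := hyint.tower_top
  have htop : IntermediateField.adjoin K {y} = ⊤ := by
    refine eq_top_iff.2 fun t _ => ?_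
    have hmem : ∀ r : A[X], r.eval₂ φ y ∈ IntermediateField.adjoin K {y} := fun r => by
      have h1 : r.eval₂ φ y = aeval y (r.map (algebraMap A K)) := by
        rw [aeval_map_algebraMap]; rfl
      rw [h1]
      exact IntermediateField.algebra_adjoin_le_adjoin K {y}
        (Polynomial.aeval_mem_adjoin_singleton K y)
    obtain ⟨r, s, rfl⟩ := hgen t
    exact div_mem (hmem r) (hmem s)
  have hsep : IsSeparable K y := by
    refine (separable_iff_derivative_ne_zero (minpoly.irreducible hyK)).2 fun h => hd0 ?_
    rw [h, map_zero]
  have hadj : Algebra.adjoin K {y} = ⊤ := by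
    rw [← IntermediateField.adjoin_simple_toSubalgebra_of_isAlgebraic hyK.isAlgebraic, htop,
      IntermediateField.top_toSubalgebra]
  have hSep : Algebra.IsSeparable K L := by
    have h1 := (IntermediateField.isSeparable_adjoin_simple_iff_isSeparable K L).2 hsep
    rw [htop] at h1
    exact Algebra.IsSeparable.of_algHom K _ (IntermediateField.topEquiv.symm : L ≃ₐ[K] _).toAlgHom
  have hfin : FiniteDimensional K L := by
    have h1 := IntermediateField.adjoin.finiteDimensional hyK
    rw [htop] at h1
    exact LinearEquiv.finiteDimensional (IntermediateField.topEquiv : _ ≃ₐ[K] L).toLinearEquiv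
  have hdual := traceForm_dualSubmodule_adjoin A K hadj hyint
  have hzmem : z ∈ (Algebra.traceForm K L).dualSubmodule
      (Subalgebra.toSubmodule (Algebra.adjoin A {y})) := by
    rw [LinearMap.BilinForm.mem_dualSubmodule]
    intro t ht
    have htint : IsIntegral A t := adjoin_le_integralClosure hyint ht
    have hzint : IsIntegral A z := hz
    rw [Algebra.traceForm_apply, Submodule.mem_one]
    exact IsIntegrallyClosed.isIntegral_iff.1 (Algebra.isIntegral_trace (hzint.mul htint))
  rw [hdual] at hzmem
  obtain ⟨t, ht, rfl⟩ := hzmem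
  obtain ⟨r, rfl⟩ := (Algebra.adjoin_singleton_eq_range_aeval A y ▸ ht : t ∈ (aeval y).range)
  refine ⟨r * .C c, ?_⟩
  rw [eval₂_mul, eval₂_C]
  simp only [DistribSMul.toLinearMap_apply, smul_eq_mul]
  rw [mul_right_comm, mul_inv_cancel_left₀ hd0]
  rfl

namespace CabCurve

variable {F : Type*} [Field F] {a b : ℕ}

/-- By the Nullstellensatz, nonsingularity says that the equation of the curve and its two partial
derivatives generate the unit ideal. -/
theorem span_partial_derivatives_eq_top (C : CabCurve F a b) :
    Ideal.span {C.poly, derivative C.poly, Bivariate.swap (derivative (Bivariate.swap C.poly))} =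
      ⊤ := by
  by_contra h
  obtain ⟨m, hm, hle⟩ := Ideal.exists_le_maximal _ h
  let : Field (F[X][Y] ⧸ m) := Ideal.Quotient.field m
  have : Algebra.FiniteType F F[X][Y] :=
    Algebra.FiniteType.trans (S := F[X]) inferInstance inferInstance
  have hft : Algebra.FiniteType F (F[X][Y] ⧸ m) :=
    Algebra.FiniteType.of_surjective (Ideal.Quotient.mkₐ F m) (Ideal.Quotient.mkₐ_surjective F m)
  have hfin : Module.Finite F (F[X][Y] ⧸ m) := finite_of_finite_type_of_isJacobsonRing F _
  let σ : (F[X][Y] ⧸ m) →ₐ[F] AlgebraicClosure F := IsAlgClosed.lift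
  let ψ : F[X][Y] →ₐ[F] AlgebraicClosure F := σ.comp (Ideal.Quotient.mkₐ F m)
  have hψ : ψ = aevalAeval (ψ (.C X)) (ψ Y) := by
    ext
    · exact (aevalAeval_X _ _).symm
    · exact (aevalAeval_Y _ _).symm
  have hker : ∀ p ∈ ({C.poly, derivative C.poly,
      Bivariate.swap (derivative (Bivariate.swap C.poly))} : Set F[X][Y]),
      aevalAeval (ψ (.C X)) (ψ Y) p = 0 := fun p hp => by
    rw [← hψ]
    have h0 : Ideal.Quotient.mkₐ F m p = 0 :=
      Ideal.Quotient.eq_zero_iff_mem.2 (hle (Ideal.subset_span hp))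
    rw [AlgHom.comp_apply, h0, map_zero]
  rcases C.nonsingular _ _ (hker _ (by simp)) with h1 | h1
  · exact h1 (hker _ (by simp))
  · rw [← Bivariate.aevalAeval_swap] at h1
    exact h1 (hker _ (by simp))

theorem eval₂_aeval_x (C : CabCurve F a b) (p : F[X][Y]) :
    p.eval₂ (aeval C.x : F[X] →ₐ[F] C.FunctionField).toRingHom C.y = aevalAeval C.x C.y p := by
  induction p using Polynomial.induction_on' with
  | add p q hp hq => rw [eval₂_add, hp, hq, map_add]
  | monomial n r =>
    rw [eval₂_monomial, ← C_mul_X_pow_eq_monomial, map_mul, map_pow, aevalAeval_C, aevalAeval_Y]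
    rfl

theorem eval₂_aeval_y (C : CabCurve F a b) (p : F[X][Y]) :
    p.eval₂ (aeval C.y : F[X] →ₐ[F] C.FunctionField).toRingHom C.x =
      aevalAeval C.x C.y (Bivariate.swap p) := by
  rw [Bivariate.aevalAeval_swap]
  induction p using Polynomial.induction_on' with
  | add p q hp hq => rw [eval₂_add, hp, hq, map_add]
  | monomial n r =>
    rw [eval₂_monomial, ← C_mul_X_pow_eq_monomial, map_mul, map_pow, aevalAeval_C, aevalAeval_Y]
    rfl

/-- A function without poles on the affine curve is a polynomial in `x` and `y`. Both partial
derivatives of the equation multiply it into the coordinate ring, and they generate the unit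
ideal there. -/
theorem exists_eq_aevalAeval_of_forall_mem (C : CabCurve F a b) {f : C.FunctionField}
    (hf : ∀ P : FFPlace F C.FunctionField, ¬ C.IsAtInfinity P → f ∈ P.ring) :
    ∃ p : F[X][Y], f = aevalAeval C.x C.y p := by
  have hV : ∀ V : ValuationSubring C.FunctionField, (∀ c : F, algebraMap F _ c ∈ V) →
      C.x ∈ V → C.y ∈ V → f ∈ V := fun V h hx hy => by
    by_cases htop : V = ⊤
    · rw [htop]; exact ValuationSubring.mem_top _
    · exact hf ⟨V, h, htop⟩ fun h' => h' ⟨hx, hy⟩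
  have h0 : aevalAeval C.x C.y C.poly = 0 := (C.aevalAeval_eq_zero_iff _).2 dvd_rfl
  have hx0 : C.poly.eval₂ (aeval C.x : F[X] →ₐ[F] C.FunctionField).toRingHom C.y = 0 := by
    rw [eval₂_aeval_x, h0]
  have hy0 : C.swap.poly.eval₂ (aeval C.y : F[X] →ₐ[F] C.FunctionField).toRingHom C.x = 0 := by
    rw [eval₂_aeval_y]
    exact (congrArg _ (Bivariate.swap_swap_apply C.poly)).trans h0
  have hfx : (aeval C.x : F[X] →ₐ[F] C.FunctionField).toRingHom.IsIntegralElem f :=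
    RingHom.isIntegralElem_of_forall_valuationSubring fun V h => hV V
      (fun c => by simpa using h (.C c)) (by simpa using h X)
      (ValuationSubring.mem_of_isIntegralElem h
        (RingHom.isIntegralElem_of_isUnit_leadingCoeff C.isUnit_leadingCoeff_poly hx0))
  have hfy : (aeval C.y : F[X] →ₐ[F] C.FunctionField).toRingHom.IsIntegralElem f :=
    RingHom.isIntegralElem_of_forall_valuationSubring fun V h => hV V
      (fun c => by simpa using h (.C c))
      (ValuationSubring.mem_of_isIntegralElem h
        (RingHom.isIntegralElem_of_isUnit_leadingCoeff C.swap.isUnit_leadingCoeff_poly hy0))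
      (by simpa using h X)
  obtain ⟨r, hr⟩ := exists_derivative_mul_eq_eval₂ C.aeval_x_injective C.irreducible
    C.isUnit_leadingCoeff_poly hx0 (fun z => by
      obtain ⟨r, s, rfl⟩ := C.exists_eq_aevalAeval_div z
      exact ⟨r, s, by rw [eval₂_aeval_x, eval₂_aeval_x]⟩) hfx
  obtain ⟨s, hs⟩ := exists_derivative_mul_eq_eval₂ C.aeval_y_injective C.swap.irreducible
    C.swap.isUnit_leadingCoeff_poly hy0 (fun z => by
      obtain ⟨r, s, rfl⟩ := C.exists_eq_aevalAeval_div z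
      exact ⟨Bivariate.swap r, Bivariate.swap s, by
        rw [eval₂_aeval_y, eval₂_aeval_y, Bivariate.swap_swap_apply, Bivariate.swap_swap_apply]⟩)
    hfy
  rw [eval₂_aeval_x, eval₂_aeval_x] at hr
  rw [eval₂_aeval_y, eval₂_aeval_y] at hs
  have h1 : (1 : F[X][Y]) ∈ Ideal.span {C.poly, derivative C.poly,
      Bivariate.swap (derivative (Bivariate.swap C.poly))} := by
    rw [span_partial_derivatives_eq_top]; exact Submodule.mem_top
  obtain ⟨u, v, w, huvw⟩ := Submodule.mem_span_triple.1 h1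
  refine ⟨v * r + w * Bivariate.swap s, ?_⟩
  have h2 := congrArg (fun p => aevalAeval C.x C.y p * f) huvw
  simp only [smul_eq_mul, map_add, map_mul, map_one, h0, mul_zero, zero_add, one_mul] at h2
  rw [map_add, map_mul, map_mul, ← hr, ← hs, ← mul_assoc, ← mul_assoc, ← add_mul]
  exact h2.symm

end CabCurve

/-! ### Values at rational places -/

namespace FFPlace

variable {F K : Type*} [Field F] [Field K] [Algebra F K]

theorem value_eq (P : FFPlace F K) {h : K} {c : F} (hc : P.Vanishes (h - algebraMap F K c)) :
    P.value h = c := by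
  have hex : ∃ c : F, P.Vanishes (h - algebraMap F K c) := ⟨c, hc⟩
  rw [value, dif_pos hex]
  by_contra hne
  have h1 := Valuation.map_sub_lt _ hc hex.choose_spec
  rw [sub_sub_sub_cancel_left, ← map_sub, P.valuation_algebraMap (sub_ne_zero.2 hne)] at h1
  exact lt_irrefl _ h1

theorem IsRational.vanishes_sub_value {P : FFPlace F K} (hP : P.IsRational) {h : K}
    (hh : h ∈ P.ring) : P.Vanishes (h - algebraMap F K (P.value h)) := by
  obtain ⟨c, hc⟩ := hP h hh
  rwa [P.value_eq hc]

theorem IsRational.value_add {P : FFPlace F K} (hP : P.IsRational) {h k : K}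
    (hh : h ∈ P.ring) (hk : k ∈ P.ring) : P.value (h + k) = P.value h + P.value k := by
  refine P.value_eq ?_
  rw [map_add, add_sub_add_comm]
  exact Valuation.map_add_lt _ (hP.vanishes_sub_value hh) (hP.vanishes_sub_value hk)

theorem IsRational.value_mul {P : FFPlace F K} (hP : P.IsRational) {h k : K}
    (hh : h ∈ P.ring) (hk : k ∈ P.ring) : P.value (h * k) = P.value h * P.value k := by
  refine P.value_eq ?_
  have e : h * k - algebraMap F K (P.value h * P.value k) =
      (h - algebraMap F K (P.value h)) * k +
        algebraMap F K (P.value h) * (k - algebraMap F K (P.value k)) := by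
    rw [map_mul]; ring
  rw [e]
  refine Valuation.map_add_lt _ ?_ ?_
  · rw [map_mul]
    exact (mul_le_of_le_one_right' ((P.ring.valuation_le_one_iff _).2 hk)).trans_lt
      (hP.vanishes_sub_value hh)
  · rw [map_mul]
    exact (mul_le_of_le_one_left' ((P.ring.valuation_le_one_iff _).2
      (P.algebraMap_mem _))).trans_lt (hP.vanishes_sub_value hk)

theorem IsRational.value_pow {P : FFPlace F K} (hP : P.IsRational) {h : K}
    (hh : h ∈ P.ring) (n : ℕ) : P.value (h ^ n) = P.value h ^ n := by
  induction n with
  | zero =>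
    rw [pow_zero, pow_zero]
    exact P.value_eq (by rw [map_one, sub_self, Vanishes, map_zero]; exact zero_lt_one)
  | succ n ih => rw [pow_succ, pow_succ, hP.value_mul (P.ring.pow_mem hh n) hh, ih]

theorem NotInSupport.div_pow_mem {P : FFPlace F K} {g : K} (hg : P.NotInSupport g) {h : K}
    (hh : h ∈ P.ring) (n : ℕ) : h / g ^ n ∈ P.ring := by
  have hg' : P.ring.valuation g = 1 := hg
  rw [← P.ring.valuation_le_one_iff, map_div₀, map_pow, hg', one_pow, div_one]
  exact (P.ring.valuation_le_one_iff _).2 hh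

theorem NotInSupport.ne_zero {P : FFPlace F K} {g : K} (hg : P.NotInSupport g) : g ≠ 0 := by
  rintro rfl
  exact zero_ne_one ((map_zero _).symm.trans hg)

end FFPlace

theorem FiniteField.algebraTrace_pow_natCard {k F : Type*} [Field k] [Field F] [Finite F]
    [Algebra k F] (c : F) : Algebra.trace k F (c ^ Nat.card k) = Algebra.trace k F c := by
  have : Finite k := Finite.of_injective _ (algebraMap k F).injective
  have := Fintype.ofFinite k
  rw [Nat.card_eq_fintype_card]
  exact Algebra.trace_eq_of_algEquiv (FiniteField.frobeniusAlgEquivOfAlgebraic k F) c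

namespace CabCurve

variable {F : Type*} [Field F] {a b : ℕ}

theorem mem_ring_of_mem_filtration (C : CabCurve F a b) {P : FFPlace F C.FunctionField}
    (hP : ¬ C.IsAtInfinity P) {d : ℕ} {f : C.FunctionField} (hf : f ∈ C.filtration d) :
    f ∈ P.ring := by
  obtain ⟨hx, hy⟩ := not_not.1 hP
  induction hf using Submodule.span_induction with
  | zero => exact P.ring.zero_mem
  | add u v _ _ hu hv => exact P.ring.add_mem _ _ hu hv
  | smul c u _ hu =>
    rw [Algebra.smul_def]
    exact P.ring.mul_mem _ _ (P.algebraMap_mem c) hu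
  | mem z hz =>
    obtain ⟨i, j, -, rfl⟩ := hz
    exact P.ring.mul_mem _ _ (P.ring.pow_mem hx i) (P.ring.pow_mem hy j)

theorem exists_mem_filtration_of_mem_remainderSpace (C : CabCurve F a b) {h f : C.FunctionField}
    (hf : f ∈ C.remainderSpace h) : ∃ d, f ∈ C.filtration d := by
  induction hf using Submodule.span_induction with
  | zero => exact ⟨0, Submodule.zero_mem _⟩
  | add u v _ _ hu hv =>
    obtain ⟨d, hu⟩ := hu
    obtain ⟨e, hv⟩ := hv
    exact ⟨max d e, Submodule.add_mem _ (C.filtration_mono (le_max_left _ _) hu)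
      (C.filtration_mono (le_max_right _ _) hv)⟩
  | smul c u _ hu =>
    obtain ⟨d, hu⟩ := hu
    exact ⟨d, Submodule.smul_mem _ _ hu⟩
  | mem z hz =>
    obtain ⟨_, _, _, u, v, _, _, _, rfl⟩ := hz
    exact ⟨_, C.monomial_mem_filtration (Nat.lt_succ_self _)⟩

/-- A function of positive weighted degree has a pole at infinity, so a place outside its support
is affine. -/
theorem HasWeightedDegree.not_isAtInfinity {C : CabCurve F a b} {g : C.FunctionField} {d : ℕ}
    (hg : C.HasWeightedDegree g d) (hd : 0 < d) {P : FFPlace F C.FunctionField}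
    (hP : P.NotInSupport g) : ¬ C.IsAtInfinity P := fun h => by
  obtain ⟨β, α, hlt, rfl⟩ := hg
  obtain ⟨c, hc, hm⟩ := hlt.exists_sub_mem_filtration
  obtain ⟨w, hw, hx, hy⟩ := h.exists_valuation_eq
  have h1 := C.valuation_eq_of_sub_mem_filtration hw hx hy hc hm
  have h2 : P.ring.valuation g = 1 := hP
  rw [h2] at h1
  exact (one_lt_pow₀ hw hd.ne').ne h1

/-! ### The reduction -/

/-- If `f` has weighted degree `d < s' (q ^ (n + 1) + 1)` and `h` is its quotient of weighted degree
`e` upon division by `g ^ (q ^ (n + 1) - q ^ n + 1)`, where `g` has weighted degree `s'`, then the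
weighted degree `q e + s'` of `h ^ q g` is less than `d`. -/
theorem weightedDegree_descent_bound {q n s' d : ℕ} (hq : 2 ≤ q)
    (hd : d + 1 ≤ s' * (q ^ (n + 1) + 1))
    {e : ℕ} (he : e + (q ^ (n + 1) - q ^ n + 1) * s' = d) : q * e + s' < d := by
  have hle : q ^ n ≤ q ^ (n + 1) := Nat.pow_le_pow_right (by omega) (Nat.le_succ n)
  obtain ⟨r, rfl⟩ := Nat.exists_eq_add_of_le hq
  obtain ⟨m, hm⟩ := Nat.exists_eq_add_of_le hle
  rw [show (2 + r) ^ (n + 1) - (2 + r) ^ n = m by omega] at he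
  have hm' : m = (1 + r) * (2 + r) ^ n := by
    rw [pow_succ] at hm
    linarith
  rw [pow_succ] at hd
  generalize (2 + r) ^ n = t at hd hm'
  subst hm'
  subst he
  have := Nat.mul_le_mul_left (1 + r) hd
  nlinarith

/-- The reduction for a polynomial function `f`, by strong induction on the bound `d` for its
weighted degree: with `q` the order of `k`, `G = g ^ (q ^ (n + 1) - q ^ n + 1)` and `f = G h + r`,
the term `G h` contributes `h / g ^ (q ^ n)`, whose `q`-th power is `h ^ q g / g ^ (q ^ (n + 1) + 1)`. -/
theorem exists_remainder_trace_eq {k : Type*} [Field k] [Finite F] [Algebra k F]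
    (C : CabCurve F a b) {n s' : ℕ} {g : C.FunctionField} (hs : 0 < s')
    (hg : C.HasWeightedDegree g s') (Pts : Set (FFPlace F C.FunctionField))
    (hPts : ∀ P ∈ Pts, P.IsRational ∧ P.NotInSupport g) {d : ℕ}
    (hd : d ≤ s' * (Nat.card k ^ (n + 1) + 1)) {f : C.FunctionField} (hf : f ∈ C.filtration d) :
    ∃ f' ∈ C.remainderSpace (g ^ (Nat.card k ^ (n + 1) - Nat.card k ^ n + 1)),
      ∀ P ∈ Pts,
        Algebra.trace k F (P.value (f / g ^ (Nat.card k ^ (n + 1) + 1))) =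
          Algebra.trace k F (P.value (f' / g ^ (Nat.card k ^ (n + 1) + 1))) := by
  have : Finite k := Finite.of_injective _ (algebraMap k F).injective
  have hq : 2 ≤ Nat.card k := Finite.one_lt_card
  have hinf : ∀ P ∈ Pts, ¬ C.IsAtInfinity P := fun P hP => hg.not_isAtInfinity hs (hPts P hP).2
  obtain ⟨β, α, hlt, hdeg⟩ := hg
  obtain ⟨B, A, hG, hGdeg⟩ := hlt.exists_pow (Nat.card k ^ (n + 1) - Nat.card k ^ n + 1)
  rw [hdeg] at hGdeg
  have hgs : g ∈ C.filtration (s' + 1) := hdeg ▸ hlt.mem_filtration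
  have htrace := FiniteField.algebraTrace_pow_natCard (k := k) (F := F)
  generalize Nat.card k = q at *
  have hle : q ^ n ≤ q ^ (n + 1) := Nat.pow_le_pow_right (by omega) (Nat.le_succ n)
  induction d using Nat.strong_induction_on generalizing f with
  | _ d ih =>
    obtain ⟨h, hh, hr⟩ := hG.exists_quotient hf
    rw [hGdeg] at hh
    -- if `f` has too small a degree, then `h = 0` and the induction stops
    obtain ⟨f₁, hf₁, htr⟩ : ∃ f₁ ∈ C.remainderSpace (g ^ (q ^ (n + 1) - q ^ n + 1)),
        ∀ P ∈ Pts, Algebra.trace k F (P.value (h ^ q * g / g ^ (q ^ (n + 1) + 1))) =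
          Algebra.trace k F (P.value (f₁ / g ^ (q ^ (n + 1) + 1))) := by
      rcases he : d - (q ^ (n + 1) - q ^ n + 1) * s' with _ | e
      · rw [he] at hh
        rw [C.eq_zero_of_mem_filtration_zero hh, zero_pow (by omega), zero_mul]
        exact ⟨0, Submodule.zero_mem _, fun _ _ => rfl⟩
      · rw [he] at hh
        have hlt' : q * e + s' + 1 < d := by
          obtain ⟨d, rfl⟩ : ∃ d', d = d' + 1 := ⟨d - 1, by omega⟩
          exact Nat.succ_lt_succ (weightedDegree_descent_bound hq hd (by omega))
        refine ih _ hlt' ?_ (hlt'.le.trans hd)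
        rw [add_right_comm]
        exact C.mul_mem_filtration (C.pow_mem_filtration hh q) hgs
    refine ⟨f - g ^ (q ^ (n + 1) - q ^ n + 1) * h + f₁, Submodule.add_mem _ hr hf₁,
      fun P hP => ?_⟩
    obtain ⟨hrat, hsupp⟩ := hPts P hP
    have hg0 := hsupp.ne_zero
    have hreg : ∀ {d : ℕ} {z : C.FunctionField}, z ∈ C.filtration d → ∀ m, z / g ^ m ∈ P.ring :=
      fun hz m => hsupp.div_pow_mem (C.mem_ring_of_mem_filtration (hinf P hP) hz) m
    obtain ⟨_, hr'⟩ := C.exists_mem_filtration_of_mem_remainderSpace hr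
    obtain ⟨_, hf₁'⟩ := C.exists_mem_filtration_of_mem_remainderSpace hf₁
    have e1 : f / g ^ (q ^ (n + 1) + 1) =
        (f - g ^ (q ^ (n + 1) - q ^ n + 1) * h) / g ^ (q ^ (n + 1) + 1) + h / g ^ q ^ n := by
      rw [show q ^ (n + 1) + 1 = (q ^ (n + 1) - q ^ n + 1) + q ^ n by omega, pow_add]
      field_simp
      ring
    have e2 : h ^ q * g / g ^ (q ^ (n + 1) + 1) = (h / g ^ q ^ n) ^ q := by
      rw [div_pow, ← pow_mul, ← pow_succ, pow_succ g]
      exact mul_div_mul_right _ _ hg0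
    rw [e1, hrat.value_add (hreg hr' _) (hreg hh _), add_div,
      hrat.value_add (hreg hr' _) (hreg hf₁' _), map_add, map_add, ← htr P hP, e2,
      hrat.value_pow (hreg hh _), htrace]

end CabCurve

theorem mainTheorem8 {k F : Type*} [Field k] [Field F] [Finite F] [Algebra k F]
    {q : ℕ} (hq : Nat.card k = q)
    {a b : ℕ} (C : CabCurve F a b)
    (Pinf : FFPlace F C.FunctionField) (hPinf : C.IsAtInfinity Pinf)
    {i s s' : ℕ} (hi : 1 ≤ i) (hs : s < s')
    {g f : C.FunctionField}
    (hg : g ∈ FFPlace.riemannRoch (Finsupp.single Pinf (s' : ℤ)))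
    (hgdeg : C.HasWeightedDegree g s')
    (hf : f ∈ FFPlace.riemannRoch (Finsupp.single Pinf ((s' : ℤ) * ((q : ℤ) ^ i + 1) - 1)))
    (Pts : Set (FFPlace F C.FunctionField))
    (hPts : ∀ P ∈ Pts, P.IsRational ∧ P.NotInSupport g) :
    ∃ f' ∈ C.remainderSpace (g ^ (q ^ i - q ^ (i - 1) + 1)),
      ∀ P ∈ Pts,
        Algebra.trace k F (P.value (f / g ^ (q ^ i + 1))) =
          Algebra.trace k F (P.value (f' / g ^ (q ^ i + 1))) := by
  subst hq
  obtain ⟨n, rfl⟩ := Nat.exists_eq_add_of_le' hi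
  have hs' : 0 < s' := by omega
  have haff : ∀ P : FFPlace F C.FunctionField, ¬ C.IsAtInfinity P → f ∈ P.ring := fun P hP => by
    have hne : Pinf ≠ P := fun h => hP (h ▸ hPinf)
    obtain ⟨t, -, ht⟩ := hf P
    rwa [Finsupp.single_eq_of_ne hne.symm, neg_zero, zpow_zero, div_one] at ht
  obtain ⟨p, rfl⟩ := C.exists_eq_aevalAeval_of_forall_mem haff
  obtain ⟨N, hN⟩ : ∃ N, N + 1 = s' * (Nat.card k ^ (n + 1) + 1) :=
    ⟨s' * (Nat.card k ^ (n + 1) + 1) - 1, Nat.sub_add_cancel (Nat.mul_pos hs' (Nat.succ_pos _))⟩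
  have hord := hf Pinf
  rw [Finsupp.single_eq_same,
    show (s' : ℤ) * ((Nat.card k : ℤ) ^ (n + 1) + 1) - 1 = N by
      rw [sub_eq_iff_eq_add]; exact_mod_cast hN.symm] at hord
  exact C.exists_remainder_trace_eq hs' hgdeg Pts hPts hN.le (hPinf.mem_filtration_of_ordGE p hord)
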